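/- Let $\Sigma=\{0,1\}^{\mathbb Z}$ be the full two-sided shift on two symbols, with the left shift $T$, and let $\mu$ be a $T$-invariant ergodic probability measure on $\Sigma$ of full support. Let $(u_n)_{n\ge 0}$ be any sequence of positive real numbers tending to $0$. For $M:\Sigma\to SL(2,\mathbb R)$ write $M^n(x)=M(T^{n-1}x)\cdots M(Tx)M(x)$, let $\|\cdot\|$ be the operator norm associated with the Euclidean norm on $\mathbb R^2$, and let $\lambda_+(M)$ denote the top Lyapunov exponent of $M$, i.e. the real number such that $\frac1n\log\|M^n(x)\|\to\lambda_+(M)$ for $\mu$-almost every $x$. Then there exists a continuous map $M:\Sigma\to SL(2,\mathbb R)$ with $\lambda_+(M)>0$ such that, for infinitely many values of $n$, $$\mu\{x : \log\|M^n(x)\|\le n\lambda_+(M)/2\}\ge u_n.$$ Moreover, if $u_n$ tends to zero slower than exponentially (that is, $u_n e^{cn}\to\infty$ for every $c>0$; for instance $u_n=1/(n+1)$), then this cocycle $M$ does not have exponential large deviations for its top exponent: it is not true that for every $\epsilon>0$ there exists $C>0$ such that, for all $n\ge 0$, $\mu\{x : |\log\|M^n(x)\|-n\lambda_+(M)|\ge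 n\epsilon\}\le Ce^{-C^{-1}n}$. -/

import Mathlib

open Filter Topology MeasureTheory

/-- The (bilateral) full shift space on two symbols, with the product topology
and the product σ-algebra. -/
abbrev TwoShift : Type := ℤ → Fin 2

/-- The left shift map `(T x)_k = x_{k+1}`. -/
def twoShiftMap (x : TwoShift) : TwoShift := fun k => x (k + 1)

/-- The iterates of the linear cocycle generated by `M` above `T`:
`M^n(x) = M(T^{n-1} x) ⋯ M(T x) M(x)`, with `M^0(x) = Id`. -/
def cocycleIter {X G : Type*} [Monoid G] (T : X → X) (M : X → G) : ℕ → X → G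
  | 0, _ => 1
  | n + 1, x => M (T^[n] x) * cocycleIter T M n x

/-- The operator norm, for the Euclidean norm on `ℝ²`, of a matrix in `SL(2, ℝ)`. -/
noncomputable def slNorm (A : Matrix.SpecialLinearGroup (Fin 2) ℝ) : ℝ :=
  ‖Matrix.toEuclideanCLM (n := Fin 2) (𝕜 := ℝ) (A : Matrix (Fin 2) (Fin 2) ℝ)‖

/-- The functions `x ↦ log ‖M^n(x)‖`. -/
noncomputable def logNormIter {X : Type*} (T : X → X)
    (M : X → Matrix.SpecialLinearGroup (Fin 2) ℝ) (n : ℕ) (x : X) : ℝ :=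
  Real.log (slNorm (cocycleIter T M n x))

/-- `lam` is the top Lyapunov exponent of the cocycle `M` above `(T, μ)`:
`log ‖M^n(x)‖ / n → lam` for `μ`-almost every `x`. -/
def IsTopLyapunovExponent {X : Type*} [MeasurableSpace X] (T : X → X) (μ : Measure X)
    (M : X → Matrix.SpecialLinearGroup (Fin 2) ℝ) (lam : ℝ) : Prop :=
  ∀ᵐ x ∂μ, Tendsto (fun n : ℕ => logNormIter T M n x / n) atTop (𝓝 lam)

/-- A family of functions `f n`, with `f n x / n → lam` almost everywhere, has exponential
large deviations if for every `ε > 0` there is `C > 0` such that, for all `n`,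
`μ {x | |f n x - n lam| ≥ n ε} ≤ C exp (-n / C)`.
The almost everywhere convergence is stated separately where this is used. -/
def HasExpLargeDeviations {X : Type*} [MeasurableSpace X] (μ : Measure X)
    (f : ℕ → X → ℝ) (lam : ℝ) : Prop :=
  ∀ ε : ℝ, 0 < ε → ∃ C : ℝ, 0 < C ∧ ∀ n : ℕ,
    μ {x | |f n x - n * lam| ≥ n * ε} ≤ ENNReal.ofReal (C * Real.exp (-(C⁻¹ * n)))

/-! Write `R` for rotations. The cocycle is `M x = R(ω x) diag(e^{x₀}, e^{-x₀})`, where `ω` is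
continuous and almost everywhere equals `θ ∘ T - θ`, for a transfer angle `θ = ∑ ψ_j` that is only
measurable. Each `ψ_j` is a phase: at steps with `x₀ = 1` it does not change and is a multiple of
`π/2`. Rotating by such an angle preserves or exchanges the two axes, so `M` is conjugate by
rotations to the diagonal cocycle with potential `φ = x₀ cos 2θ`, which is `±x₀`. Hence `log ‖M^n‖ =
|S_n φ|` almost everywhere, and the exponent is `∫ φ`, positive because the `ψ_j` vanish off a set
of small measure.

A deviation at time `n` comes from reversing the sign of the potential halfway through the orbit
segment: the second half then undoes the growth of the first. The angle moves between `0` and `π/2`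
in steps of size at most `π/(2L)`, and only while the orbit reads blocks of `L` zeros, where the
diagonal factor is the identity. Recurrence provides pairs of such blocks at arbitrarily large
distances `n`, with probability bounded below independently of `n`. A clopen Rokhlin lemma selects
well separated occurrences, so that the support stays small. The resulting deviation has probability
at least a constant independent of `n`, which exceeds `2 u n` once `n` is large
(`exists_isPhase_large_deviation`).

Iterating with rapidly decreasing sizes makes the increments `ψ_j ∘ T - ψ_j` uniformly summable and
prevents later stages from spoiling earlier deviations (`exists_seq_isPhase`). -/

/-! ### Pointwise ergodic theorem for bounded functions -/

/-- The running maximum of the Birkhoff sums of `f` up to time `n`. -/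
noncomputable def birkhoffMax {X : Type*} (T : X → X) (f : X → ℝ) : ℕ → X → ℝ
  | 0, _ => 0
  | n + 1, x => max 0 (f x + birkhoffMax T f n (T x))

section Birkhoff

variable {X : Type*} {T : X → X} {f : X → ℝ}

theorem birkhoffMax_nonneg (n : ℕ) (x : X) : 0 ≤ birkhoffMax T f n x := by
  cases n with
  | zero => exact le_rfl
  | succ n => exact le_max_left _ _

theorem birkhoffMax_le_succ (n : ℕ) : ∀ x : X, birkhoffMax T f n x ≤ birkhoffMax T f (n + 1) x := by
  induction n with
  | zero => intro x; exact birkhoffMax_nonneg _ _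
  | succ n ih =>
    intro x
    exact max_le_max le_rfl (add_le_add le_rfl (ih (T x)))

theorem birkhoffSum_le_birkhoffMax (n : ℕ) :
    ∀ (k : ℕ) (x : X), k ≤ n → birkhoffSum T f k x ≤ birkhoffMax T f n x := by
  induction n with
  | zero =>
    intro k x hk
    obtain rfl : k = 0 := by omega
    simp [birkhoffMax]
  | succ n ih =>
    intro k x hk
    cases k with
    | zero => simpa using birkhoffMax_nonneg _ _
    | succ k =>
      rw [birkhoffSum_succ']
      exact le_max_of_le_right (add_le_add le_rfl (ih k (T x) (by omega)))

theorem birkhoffMax_le {C : ℝ} (hC : ∀ x, |f x| ≤ C) (n : ℕ) :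
    ∀ x : X, birkhoffMax T f n x ≤ n * C := by
  induction n with
  | zero => intro x; simp [birkhoffMax]
  | succ n ih =>
    intro x
    have h0 : 0 ≤ C := (abs_nonneg _).trans (hC x)
    refine max_le (by positivity) ?_
    have h1 := ih (T x)
    have h2 := (le_abs_self _).trans (hC x)
    push_cast
    linarith

theorem bddAbove_birkhoffSum_comp_iff (x : X) :
    BddAbove (Set.range fun n => birkhoffSum T f n (T x)) ↔
      BddAbove (Set.range fun n => birkhoffSum T f n x) := by
  constructor
  · rintro ⟨K, hK⟩
    refine ⟨max 0 (f x + K), ?_⟩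
    rintro _ ⟨n, rfl⟩
    cases n with
    | zero => simp
    | succ n =>
      simp only [birkhoffSum_succ']
      exact le_max_of_le_right (add_le_add le_rfl (hK ⟨n, rfl⟩))
  · rintro ⟨K, hK⟩
    refine ⟨K - f x, ?_⟩
    rintro _ ⟨n, rfl⟩
    have := hK ⟨n + 1, rfl⟩
    simp only [birkhoffSum_succ'] at this
    simp only
    linarith

theorem birkhoffSum_sub_const (c : ℝ) (n : ℕ) (x : X) :
    birkhoffSum T (fun y => f y - c) n x = birkhoffSum T f n x - n * c := by
  simp [birkhoffSum, Finset.sum_sub_distrib]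

variable [MeasurableSpace X] {μ : Measure X}

theorem measurable_birkhoffMax (hT : Measurable T) (hf : Measurable f) (n : ℕ) :
    Measurable (birkhoffMax T f n) := by
  induction n with
  | zero => exact measurable_const
  | succ n ih => exact measurable_const.max (hf.add (ih.comp hT))

theorem measurable_birkhoffSum (hT : Measurable T) (hf : Measurable f) (n : ℕ) :
    Measurable (birkhoffSum T f n) := by
  unfold birkhoffSum
  exact Finset.measurable_fun_sum _ fun k _ => hf.comp (hT.iterate k)

theorem integrable_of_abs_le [IsFiniteMeasure μ] (hf : Measurable f) {C : ℝ}
    (hC : ∀ x, |f x| ≤ C) : Integrable f μ :=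
  Integrable.of_bound hf.aestronglyMeasurable C (ae_of_all _ hC)

/-- Maximal ergodic theorem: the Birkhoff sums of a bounded function with negative mean are
almost surely bounded above. -/
theorem Ergodic.ae_bddAbove_birkhoffSum [IsProbabilityMeasure μ] (hT : Ergodic T μ)
    (hf : Measurable f) {C : ℝ} (hC : ∀ x, |f x| ≤ C) (hneg : ∫ x, f x ∂μ < 0) :
    ∀ᵐ x ∂μ, BddAbove (Set.range fun n => birkhoffSum T f n x) := by
  have hTm : Measurable T := hT.measurable
  set A : Set X := {x | BddAbove (Set.range fun n => birkhoffSum T f n x)} with hA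
  have hAm : MeasurableSet A :=
    measurableSet_bddAbove_range fun n => measurable_birkhoffSum hTm hf n
  have hAT : T ⁻¹' A = A := by
    ext x
    exact bddAbove_birkhoffSum_comp_iff x
  rcases hT.toPreErgodic.ae_mem_or_ae_notMem hAm hAT with h | h
  · exact h
  exfalso
  have hint : ∀ n, Integrable (birkhoffMax T f n) μ := fun n =>
    integrable_of_abs_le (C := n * C) (measurable_birkhoffMax hTm hf n) fun x => by
      rw [abs_of_nonneg (birkhoffMax_nonneg n x)]
      exact birkhoffMax_le hC n x
  have hintT : ∀ n, Integrable (fun x => birkhoffMax T f n (T x)) μ := fun n =>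
    hT.toMeasurePreserving.integrable_comp_of_integrable (hint n)
  -- If the sums are almost surely unbounded above, then `birkhoffMax` at `T x` eventually exceeds
  -- `-f x`, the outer maximum with `0` becomes inactive, and the difference equals `f x`. Its
  -- integral is nonnegative for every `n`, by invariance and monotonicity in `n`, which contradicts
  -- a negative mean.
  have hlim : Tendsto (fun n => ∫ x, (birkhoffMax T f (n + 1) x - birkhoffMax T f n (T x)) ∂μ)
      atTop (𝓝 (∫ x, f x ∂μ)) := by
    refine tendsto_integral_of_dominated_convergence (fun _ => C)
      (fun n => ((hint _).sub (hintT n)).aestronglyMeasurable) (integrable_const C) ?_ ?_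
    · intro n
      refine ae_of_all _ fun x => ?_
      have h0 := birkhoffMax_nonneg (T := T) (f := f) n (T x)
      have h1 := abs_le.1 (hC x)
      change |max 0 (f x + birkhoffMax T f n (T x)) - _| ≤ C
      rw [abs_le]
      rcases max_cases 0 (f x + birkhoffMax T f n (T x)) with ⟨h2, h3⟩ | ⟨h2, h3⟩ <;> rw [h2] <;>
        constructor <;> linarith
    · filter_upwards [h] with x hx
      refine tendsto_const_nhds.congr' ?_
      have hx' : ¬ BddAbove (Set.range fun n => birkhoffSum T f n (T x)) := by
        rwa [bddAbove_birkhoffSum_comp_iff]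
      rw [not_bddAbove_iff] at hx'
      obtain ⟨_, ⟨k, rfl⟩, hk⟩ := hx' (-f x)
      filter_upwards [eventually_ge_atTop k] with n hn
      have h1 := birkhoffSum_le_birkhoffMax (T := T) (f := f) n k (T x) hn
      change f x = max 0 (f x + birkhoffMax T f n (T x)) - _
      rw [max_eq_right (by simp only at hk; linarith)]
      ring
  have hge : 0 ≤ ∫ x, f x ∂μ := by
    refine ge_of_tendsto' hlim fun n => ?_
    rw [integral_sub (hint _) (hintT n)]
    have h1 : ∫ x, birkhoffMax T f n (T x) ∂μ = ∫ x, birkhoffMax T f n x ∂μ := by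
      rw [← integral_map hTm.aemeasurable
        (measurable_birkhoffMax hTm hf n).aestronglyMeasurable, hT.map_eq]
    rw [h1, sub_nonneg]
    exact integral_mono (hint _) (hint _) fun x => birkhoffMax_le_succ n x
  linarith

theorem Ergodic.ae_eventually_birkhoffSum_le [IsProbabilityMeasure μ] (hT : Ergodic T μ)
    (hf : Measurable f) {C : ℝ} (hC : ∀ x, |f x| ≤ C) {ε : ℝ} (hε : 0 < ε) :
    ∀ᵐ x ∂μ, ∀ᶠ n : ℕ in atTop, birkhoffSum T f n x ≤ n * (∫ y, f y ∂μ + ε) := by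
  set c := ∫ y, f y ∂μ + ε / 2 with hc
  have hint := integrable_of_abs_le (μ := μ) hf hC
  have h := hT.ae_bddAbove_birkhoffSum (f := fun y => f y - c) (hf.sub measurable_const)
    (C := C + |c|) (fun x => (abs_sub _ _).trans (add_le_add (hC x) le_rfl)) (by
      rw [integral_sub hint (integrable_const _)]
      simp [hc, hε])
  filter_upwards [h] with x hx
  obtain ⟨K, hK⟩ := hx
  obtain ⟨N, hN⟩ := exists_nat_ge (K / (ε / 2))
  filter_upwards [eventually_ge_atTop N] with n hn
  have h1 := hK ⟨n, rfl⟩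
  simp only [birkhoffSum_sub_const] at h1
  rw [div_le_iff₀ (by positivity)] at hN
  have h2 : (N : ℝ) * (ε / 2) ≤ n * (ε / 2) := by gcongr
  rw [hc] at h1
  linarith

/-- Birkhoff's pointwise ergodic theorem for bounded functions. -/
theorem Ergodic.ae_tendsto_birkhoffSum_div [IsProbabilityMeasure μ] (hT : Ergodic T μ)
    (hf : Measurable f) {C : ℝ} (hC : ∀ x, |f x| ≤ C) :
    ∀ᵐ x ∂μ, Tendsto (fun n : ℕ => birkhoffSum T f n x / n) atTop (𝓝 (∫ y, f y ∂μ)) := by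
  have h1 : ∀ᵐ x ∂μ, ∀ k : ℕ, ∀ᶠ n : ℕ in atTop,
      birkhoffSum T f n x ≤ n * (∫ y, f y ∂μ + 1 / ((k : ℝ) + 1)) :=
    ae_all_iff.2 fun k => hT.ae_eventually_birkhoffSum_le hf hC Nat.one_div_pos_of_nat
  have h2 : ∀ᵐ x ∂μ, ∀ k : ℕ, ∀ᶠ n : ℕ in atTop,
      birkhoffSum T (fun y => - f y) n x ≤ n * (∫ y, - f y ∂μ + 1 / ((k : ℝ) + 1)) :=
    ae_all_iff.2 fun k => hT.ae_eventually_birkhoffSum_le hf.neg (C := C)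
      (fun x => by simpa using hC x) Nat.one_div_pos_of_nat
  filter_upwards [h1, h2] with x hx1 hx2
  rw [Metric.tendsto_atTop']
  intro ε hε
  obtain ⟨k, hk⟩ := exists_nat_one_div_lt hε
  obtain ⟨N, hN⟩ := eventually_atTop.1 ((hx1 k).and (hx2 k))
  refine ⟨N, fun n hn => ?_⟩
  obtain ⟨h3, h4⟩ := hN n hn.le
  have hn0 : (0 : ℝ) < n := by exact_mod_cast (Nat.zero_le N).trans_lt hn
  rw [integral_neg] at h4
  have h5 : birkhoffSum T (fun y => - f y) n x = - birkhoffSum T f n x := by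
    simp [birkhoffSum]
  rw [h5] at h4
  rw [Real.dist_eq, abs_lt]
  constructor
  · rw [lt_sub_iff_add_lt, lt_div_iff₀ hn0]
    nlinarith
  · rw [sub_lt_iff_lt_add, div_lt_iff₀ hn0]
    nlinarith

end Birkhoff

/-! ### Recurrence and a clopen Rokhlin lemma -/

section Recurrence

variable {X : Type*} [MeasurableSpace X] {μ : Measure X} {T : X → X}

theorem MeasureTheory.MeasurePreserving.measureReal_iterate_preimage (hT : MeasurePreserving T μ μ)
    {A : Set X} (hA : MeasurableSet A) (n : ℕ) : μ.real (T^[n] ⁻¹' A) = μ.real A :=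
  (hT.iterate n).measureReal_preimage hA.nullMeasurableSet

theorem exists_measureReal_iUnion_ge_le [IsFiniteMeasure μ] {B : ℕ → Set X}
    (hB : ∀ n, MeasurableSet (B n)) (h : ∀ᵐ x ∂μ, ∀ᶠ n in atTop, x ∉ B n) {p : ℝ} (hp : 0 < p) :
    ∃ N : ℕ, μ.real (⋃ n, ⋃ _ : N ≤ n, B n) ≤ p := by
  have hanti : Antitone fun N : ℕ => ⋃ n, ⋃ _ : N ≤ n, B n := by
    intro N N' hN x hx
    simp only [Set.mem_iUnion, exists_prop] at hx ⊢
    obtain ⟨n, hn, hx⟩ := hx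
    exact ⟨n, hN.trans hn, hx⟩
  have hlim := tendsto_measure_iInter_atTop (μ := μ)
    (s := fun N : ℕ => ⋃ n, ⋃ _ : N ≤ n, B n)
    (fun N => (MeasurableSet.iUnion fun n => MeasurableSet.iUnion fun _ =>
      hB n).nullMeasurableSet) hanti ⟨0, measure_ne_top _ _⟩
  have h0 : μ (⋂ N : ℕ, ⋃ n, ⋃ _ : N ≤ n, B n) = 0 := by
    rw [← compl_compl (⋂ N : ℕ, ⋃ n, ⋃ _ : N ≤ n, B n)]
    refine mem_ae_iff.1 ?_
    filter_upwards [h] with x hx hmem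
    obtain ⟨N, hN⟩ := eventually_atTop.1 hx
    simp only [Set.mem_iInter, Set.mem_iUnion, exists_prop] at hmem
    obtain ⟨n, hn, hxn⟩ := hmem N
    exact hN n hn hxn
  rw [h0] at hlim
  obtain ⟨N, hN⟩ := (hlim.eventually_lt_const (ENNReal.ofReal_pos.2 hp)).exists
  exact ⟨N, ENNReal.toReal_le_of_le_ofReal hp.le hN.le⟩

/-- Quantitative recurrence along multiples of an arbitrary integer. -/
theorem MeasureTheory.MeasurePreserving.exists_le_measureReal_inter_preimage
    [IsProbabilityMeasure μ] (hT : MeasurePreserving T μ μ) {B : Set X} (hB : MeasurableSet B)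
    (hpos : 0 < μ.real B) :
    ∃ c : ℝ, 0 < c ∧ ∀ N : ℕ, ∃ v : ℕ, 1 ≤ v ∧ c ≤ μ.real (B ∩ T^[v * N] ⁻¹' B) := by
  obtain ⟨K, hK⟩ := exists_nat_gt (2 / μ.real B)
  have hK0 : (0 : ℝ) < K := lt_trans (by positivity) hK
  rw [div_lt_iff₀ hpos] at hK
  -- Pigeonhole among the `K` preimages of `B` at times `i * N`: were all pairwise overlaps below
  -- this constant, each preimage would contribute at least `μ.real B / 2` of new mass, in total
  -- more than `1`.
  refine ⟨μ.real B / (2 * K), by positivity, fun N => ?_⟩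
  by_contra! hcon
  set c := μ.real B / (2 * K) with hc
  have hcK : c * K = μ.real B / 2 := by rw [hc]; field_simp
  set A : ℕ → Set X := fun i => T^[i * N] ⁻¹' B with hA
  have hAm : ∀ i, MeasurableSet (A i) := fun i => (hT.measurable.iterate _) hB
  have hinter : ∀ i j, j < i → μ.real (A i ∩ A j) ≤ c := by
    intro i j hji
    have : A i ∩ A j = T^[j * N] ⁻¹' (B ∩ T^[(i - j) * N] ⁻¹' B) := by
      ext x
      have h1 : i * N = (i - j) * N + j * N := by
        rw [← Nat.add_mul, Nat.sub_add_cancel hji.le]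
      simp only [hA, Set.mem_inter_iff, Set.mem_preimage]
      rw [h1, Function.iterate_add_apply]
      tauto
    rw [this, hT.measureReal_iterate_preimage (hB.inter ((hT.measurable.iterate _) hB))]
    exact (hcon (i - j) (by omega)).le
  have hD : ∀ i ∈ Finset.range K, μ.real B / 2 ≤ μ.real (disjointed A i) := by
    intro i hi
    rw [Finset.mem_range] at hi
    have hsub : A i ⊆ disjointed A i ∪ ⋃ j ∈ Finset.range i, A i ∩ A j := by
      intro x hx
      by_cases h : ∃ j < i, x ∈ A j
      · obtain ⟨j, hj, hxj⟩ := h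
        right
        simp only [Set.mem_iUnion, Finset.mem_range]
        exact ⟨j, hj, hx, hxj⟩
      · left
        push Not at h
        rw [disjointed_eq_inter_compl]
        exact ⟨hx, by simpa using h⟩
    have h1 : μ.real (A i) ≤ μ.real (disjointed A i) + ∑ j ∈ Finset.range i, c :=
      calc μ.real (A i) ≤ _ := measureReal_mono hsub
        _ ≤ _ := measureReal_union_le _ _
        _ ≤ _ := by
          gcongr
          refine (measureReal_biUnion_finset_le _ _).trans (Finset.sum_le_sum fun j hj => ?_)
          exact hinter i j (Finset.mem_range.1 hj)
    rw [hT.measureReal_iterate_preimage hB] at h1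
    simp only [Finset.sum_const, Finset.card_range, nsmul_eq_mul] at h1
    have h2 : (i : ℝ) * c ≤ K * c := by
      have : (0 : ℝ) ≤ c := by positivity
      gcongr
    linarith
  have hsum : ∑ i ∈ Finset.range K, μ.real (disjointed A i) ≤ 1 := by
    rw [← measureReal_biUnion_finset (fun i _ j _ hij => disjoint_disjointed A hij)
      fun i _ => MeasurableSet.disjointed hAm i]
    exact measureReal_le_one
  have h3 := Finset.card_nsmul_le_sum _ _ _ hD
  simp only [Finset.card_range, nsmul_eq_mul] at h3
  linarith

theorem Ergodic.ae_exists_iterate_mem [IsFiniteMeasure μ] (hT : Ergodic T μ) {E : Set X}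
    (hE : MeasurableSet E) (hpos : μ E ≠ 0) : ∀ᵐ x ∂μ, ∃ t : ℕ, T^[t] x ∈ E := by
  set V : Set X := ⋃ t : ℕ, T^[t] ⁻¹' E with hV
  have hVm : MeasurableSet V := MeasurableSet.iUnion fun t => (hT.measurable.iterate t) hE
  have hsub : T ⁻¹' V ⊆ V := by
    intro x hx
    simp only [hV, Set.mem_preimage, Set.mem_iUnion] at hx ⊢
    obtain ⟨t, ht⟩ := hx
    exact ⟨t + 1, by rwa [Function.iterate_succ_apply]⟩
  rcases hT.ae_empty_or_univ_of_preimage_ae_le hVm.nullMeasurableSet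
    (LE.le.eventuallyLE hsub) with h | h
  · refine absurd (measure_mono_null ?_ (ae_eq_empty.1 h)) hpos
    intro x hx
    exact Set.mem_iUnion.2 ⟨0, hx⟩
  · filter_upwards [eventuallyEq_univ.1 h] with x hx
    simpa [hV] using hx

/-- A topological Rokhlin lemma inside a clopen set: a clopen set contains a clopen subset
without returns before time `H`, of measure comparable to `1 / H`. -/
theorem Ergodic.exists_isClopen_separated [TopologicalSpace X] [OpensMeasurableSpace X]
    [IsFiniteMeasure μ] (hT : Ergodic T μ) (hTc : Continuous T)
    (hsmall : ∀ ε : ℝ, 0 < ε → ∃ E : Set X, IsClopen E ∧ μ E ≠ 0 ∧ μ.real E < ε)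
    {C : Set X} (hC : IsClopen C) (hCpos : 0 < μ.real C) {H : ℕ} (hH : 0 < H) :
    ∃ Q ⊆ C, IsClopen Q ∧ (∀ x ∈ Q, ∀ k, 0 < k → k < H → T^[k] x ∉ Q) ∧
      μ.real C ≤ 2 * H * μ.real Q := by
  have hH' : (0 : ℝ) < H := by exact_mod_cast hH
  -- This bound on the measure of `E` makes the points that enter `E` before time `H` cost at most a
  -- quarter of the measure of `C`.
  obtain ⟨E, hE, hE0, hEs⟩ := hsmall (μ.real C / (4 * H)) (by positivity)
  set A : ℕ → Set X := fun t => {x | T^[t] x ∈ E ∧ ∀ k < t, T^[k] x ∉ E} with hA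
  have hAc : ∀ t, IsClopen (A t) := by
    intro t
    have : A t = T^[t] ⁻¹' E ∩ ⋂ k ∈ Finset.range t, (T^[k] ⁻¹' E)ᶜ := by
      ext x; simp [hA]
    rw [this]
    exact (hE.preimage (hTc.iterate t)).inter
      (isClopen_biInter_finset fun k _ => (hE.preimage (hTc.iterate k)).compl)
  have hAu : ∀ {x t t'}, x ∈ A t → x ∈ A t' → t = t' := by
    intro x t t' h h'
    rcases lt_trichotomy t t' with hlt | rfl | hlt
    · exact absurd h.1 (h'.2 t hlt)
    · rfl
    · exact absurd h'.1 (h.2 t' hlt)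
  have hAs : ∀ {x t k}, x ∈ A t → k ≤ t → T^[k] x ∈ A (t - k) := by
    intro x t k h hk
    refine ⟨?_, fun j hj => ?_⟩
    · rw [← Function.iterate_add_apply, Nat.sub_add_cancel hk]; exact h.1
    · rw [← Function.iterate_add_apply]; exact h.2 _ (by omega)
  have hZm : ∀ n : ℕ, MeasurableSet {x | ∀ t < n, T^[t] x ∉ E} := by
    intro n
    have : {x | ∀ t < n, T^[t] x ∉ E} = ⋂ t ∈ Finset.range n, (T^[t] ⁻¹' E)ᶜ := by
      ext x; simp
    rw [this]
    exact (isClopen_biInter_finset fun k _ => (hE.preimage (hTc.iterate k)).compl).2.measurableSet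
  obtain ⟨N, hN⟩ := exists_measureReal_iUnion_ge_le (μ := μ) hZm (by
    filter_upwards [hT.ae_exists_iterate_mem hE.2.measurableSet hE0] with x hx
    obtain ⟨t, ht⟩ := hx
    filter_upwards [eventually_gt_atTop t] with n hn hmem
    exact hmem t hn ht) (p := μ.real C / 4) (by positivity)
  -- `A t` is the set where the first hitting time of `E` is `t`. This time drops by one at each
  -- step until `E` is reached, so fixing its residue mod `H` and requiring `H ≤ t` forbids returns
  -- before time `H`. The truncation at `N` keeps the unions finite, hence clopen; at least half of
  -- `C` remains, and some residue class carries a fraction `1 / H` of that half.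
  set I : ℕ → Finset ℕ := fun r => {t ∈ Finset.range N | H ≤ t ∧ t % H = r} with hI
  set P : ℕ → Set X := fun r => C ∩ ⋃ t ∈ I r, A t with hP
  have hcover : C ⊆ (⋃ r ∈ Finset.range H, P r) ∪ (⋃ t ∈ Finset.range H, T^[t] ⁻¹' E) ∪
      ⋃ n, ⋃ _ : N ≤ n, {x | ∀ t < n, T^[t] x ∉ E} := by
    intro x hx
    by_cases h : ∃ t < N, T^[t] x ∈ E
    · left
      classical
      have h' : ∃ t, t < N ∧ T^[t] x ∈ E := h
      obtain ⟨htN, htE⟩ := Nat.find_spec h'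
      set t := Nat.find h'
      have htA : x ∈ A t := ⟨htE, fun k hk hkE => Nat.find_min h' hk ⟨hk.trans htN, hkE⟩⟩
      by_cases htH : H ≤ t
      · left
        simp only [Set.mem_iUnion, Finset.mem_range]
        refine ⟨t % H, Nat.mod_lt _ hH, hx, ?_⟩
        simp only [Set.mem_iUnion]
        exact ⟨t, by simp [hI, htN, htH], htA⟩
      · right
        simp only [Set.mem_iUnion, Finset.mem_range]
        exact ⟨t, by omega, htE⟩
    · right
      push Not at h
      simp only [Set.mem_iUnion]
      exact ⟨N, le_rfl, h⟩
  have hmeas : μ.real C ≤ ∑ r ∈ Finset.range H, μ.real (P r) + H * μ.real E + μ.real C / 4 :=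
    calc μ.real C ≤ _ := measureReal_mono hcover
      _ ≤ _ := measureReal_union_le _ _
      _ ≤ _ := add_le_add (measureReal_union_le _ _) hN
      _ ≤ _ := by
        gcongr
        · exact measureReal_biUnion_finset_le _ _
        · refine (measureReal_biUnion_finset_le _ _).trans ?_
          simp [hT.toMeasurePreserving.measureReal_iterate_preimage hE.2.measurableSet]
  have hEH : H * μ.real E ≤ μ.real C / 4 := by
    have := (lt_div_iff₀ (by positivity : (0 : ℝ) < 4 * H)).1 hEs
    linarith
  obtain ⟨r, hr, hrP⟩ : ∃ r ∈ Finset.range H, μ.real C / (2 * H) ≤ μ.real (P r) := by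
    refine Finset.exists_le_of_sum_le (Finset.nonempty_range_iff.2 hH.ne') ?_
    have : (H : ℝ) * (μ.real C / (2 * H)) = μ.real C / 2 := by field_simp
    simp only [Finset.sum_const, Finset.card_range, nsmul_eq_mul]
    linarith
  refine ⟨P r, Set.inter_subset_left,
    hC.inter (isClopen_biUnion_finset fun t _ => hAc t), ?_, ?_⟩
  · intro x hx k hk hkH hxk
    obtain ⟨-, hx⟩ := hx
    obtain ⟨-, hxk⟩ := hxk
    simp only [hI, Set.mem_iUnion, Finset.mem_filter, Finset.mem_range] at hx hxk
    obtain ⟨t, ⟨-, htH, htr⟩, hxt⟩ := hx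
    obtain ⟨t', ⟨-, -, htr'⟩, hxt'⟩ := hxk
    have h1 := hAu (hAs hxt (by omega)) hxt'
    have h2 : (t' + k) % H = (t' + 0) % H := by
      rw [add_zero, htr', ← htr]; congr 1; omega
    have h3 : k % H = 0 % H := Nat.ModEq.add_left_cancel' t' h2
    rw [Nat.mod_eq_of_lt hkH, Nat.zero_mod] at h3
    omega
  · rw [div_le_iff₀ (by positivity)] at hrP
    linarith

end Recurrence

/-! ### The shift space -/

section Shift

theorem twoShiftMap_iterate_apply (n : ℕ) (x : TwoShift) (k : ℤ) :
    twoShiftMap^[n] x k = x (k + n) := by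
  induction n generalizing x with
  | zero => simp
  | succ n ih =>
    rw [Function.iterate_succ_apply, ih, twoShiftMap]
    congr 1
    push_cast
    ring

theorem continuous_twoShiftMap : Continuous twoShiftMap :=
  continuous_pi fun k => continuous_apply (k + 1)

theorem isClopen_coord_eq (k : ℤ) (a : Fin 2) : IsClopen {x : TwoShift | x k = a} :=
  (isClopen_discrete {a}).preimage (continuous_apply k)

/-- A finite measure has only countably many atoms, so some point is null. Small clopen
neighbourhoods of it have small measure, which is nonzero by full support. -/
theorem exists_isClopen_measureReal_lt (μ : Measure TwoShift) [IsProbabilityMeasure μ]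
    [μ.IsOpenPosMeasure] (ε : ℝ) (hε : 0 < ε) :
    ∃ E : Set TwoShift, IsClopen E ∧ μ E ≠ 0 ∧ μ.real E < ε := by
  obtain ⟨x, hx⟩ : ∃ x : TwoShift, μ {x} = 0 := by
    by_contra! h
    have hc : Set.Countable {x : TwoShift | 0 < μ {x}} :=
      Measure.countable_meas_pos_of_disjoint_iUnion (fun x => measurableSet_singleton x)
        fun x y hxy => Set.disjoint_singleton.2 hxy
    have hu : {x : TwoShift | 0 < μ {x}} = Set.univ :=
      Set.eq_univ_of_forall fun x => pos_iff_ne_zero.2 (h x)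
    rw [hu, Set.countable_univ_iff] at hc
    have : Uncountable TwoShift := by
      rw [← Cardinal.aleph0_lt_mk_iff]
      change Cardinal.aleph0 < Cardinal.mk (ℤ → Fin 2)
      rw [← Cardinal.power_def]
      simpa using Cardinal.cantor Cardinal.aleph0
    exact not_countable hc
  obtain ⟨U, hxU, hU, hμU⟩ := Set.exists_isOpen_lt_of_lt {x} (ENNReal.ofReal ε)
    (by rw [hx]; exact ENNReal.ofReal_pos.2 hε)
  obtain ⟨E, hE, hxE, hEU⟩ := compact_exists_isClopen_in_isOpen hU (hxU rfl)
  refine ⟨E, hE, hE.2.measure_ne_zero μ ⟨x, hxE⟩, ?_⟩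
  have h1 : μ E < ENNReal.ofReal ε := (measure_mono hEU).trans_lt hμU
  exact (ENNReal.lt_ofReal_iff_toReal_lt (measure_ne_top _ _)).1 h1

end Shift

/-! ### Phases and the bump perturbation -/

section Phase

/-- A continuous angle which is a locally constant multiple of `π / 2` along the times where the
zeroth coordinate equals `1`. -/
structure IsPhase (ψ : TwoShift → ℝ) : Prop where
  continuous : Continuous ψ
  exists_eq : ∀ x : TwoShift, x 0 = 1 → ∃ k : ℤ, ψ x = k * (Real.pi / 2)
  map_eq : ∀ x : TwoShift, x 0 = 1 → ψ (twoShiftMap x) = ψ x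

theorem IsPhase.zero : IsPhase fun _ => 0 :=
  ⟨continuous_const, fun _ _ => ⟨0, by simp⟩, fun _ _ => rfl⟩

theorem IsPhase.add {ψ ψ' : TwoShift → ℝ} (h : IsPhase ψ) (h' : IsPhase ψ') :
    IsPhase fun x => ψ x + ψ' x where
  continuous := h.continuous.add h'.continuous
  exists_eq x hx := by
    obtain ⟨k, hk⟩ := h.exists_eq x hx
    obtain ⟨k', hk'⟩ := h'.exists_eq x hx
    exact ⟨k + k', by rw [hk, hk']; push_cast; ring⟩
  map_eq x hx := by rw [h.map_eq x hx, h'.map_eq x hx]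

/-- The potential governing the growth of the cocycle with angle `Φ`. -/
noncomputable def signedCoord (Φ : TwoShift → ℝ) (x : TwoShift) : ℝ :=
  ((x 0 : Fin 2) : ℕ) * Real.cos (2 * Φ x)

theorem fin_two_val_eq (a : Fin 2) : ((a : ℕ) : ℝ) = if a = 1 then 1 else 0 := by
  fin_cases a <;> simp

theorem measurable_coord : Measurable fun x : TwoShift => (((x 0 : Fin 2) : ℕ) : ℝ) :=
  (measurable_from_top (f := fun a : Fin 2 => ((a : ℕ) : ℝ))).comp (measurable_pi_apply 0)

theorem measurable_signedCoord {Φ : TwoShift → ℝ} (hΦ : Measurable Φ) :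
    Measurable (signedCoord Φ) :=
  measurable_coord.mul (Real.measurable_cos.comp (measurable_const.mul hΦ))

theorem abs_signedCoord_le (Φ : TwoShift → ℝ) (x : TwoShift) : |signedCoord Φ x| ≤ 1 := by
  rw [signedCoord, fin_two_val_eq]
  split_ifs
  · simpa using Real.abs_cos_le_one _
  · simp

theorem signedCoord_of_ne {Φ : TwoShift → ℝ} {x : TwoShift} (hx : x 0 ≠ 1) :
    signedCoord Φ x = 0 := by
  rw [signedCoord, fin_two_val_eq, if_neg hx, zero_mul]

/-- A trapezoidal profile rising from `0` to `π / 2` over the first `L` steps and descending over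
the last `L` steps before `W`. -/
noncomputable def trapezoid (L W j : ℕ) : ℝ := Real.pi / 2 / L * (min (min j L) (W - j) : ℕ)

theorem trapezoid_zero (L W : ℕ) : trapezoid L W 0 = 0 := by simp [trapezoid]

theorem trapezoid_of_ge {L W j : ℕ} (h : W ≤ j) : trapezoid L W j = 0 := by
  simp [trapezoid, Nat.sub_eq_zero_of_le h]

theorem trapezoid_of_mem {L n j : ℕ} (hL : 0 < L) (h : L ≤ j) (h' : j ≤ n) :
    trapezoid L (n + L) j = Real.pi / 2 := by
  have : min (min j L) (n + L - j) = L := by omega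
  rw [trapezoid, this]
  have : (L : ℝ) ≠ 0 := by exact_mod_cast hL.ne'
  field_simp

theorem abs_trapezoid_sub_le (L W j : ℕ) :
    |trapezoid L W j - trapezoid L W (j + 1)| ≤ Real.pi / 2 / L := by
  have h0 : 0 ≤ Real.pi / 2 / L := by positivity
  rw [trapezoid, trapezoid, ← mul_sub, abs_mul, abs_of_nonneg h0]
  refine mul_le_of_le_one_right h0 ?_
  have h1 : min (min j L) (W - j) ≤ min (min (j + 1) L) (W - (j + 1)) + 1 := by omega
  have h2 : min (min (j + 1) L) (W - (j + 1)) ≤ min (min j L) (W - j) + 1 := by omega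
  have h1' : ((min (min j L) (W - j) : ℕ) : ℝ) ≤ (min (min (j + 1) L) (W - (j + 1)) : ℕ) + 1 := by
    exact_mod_cast h1
  have h2' : ((min (min (j + 1) L) (W - (j + 1)) : ℕ) : ℝ) ≤ (min (min j L) (W - j) : ℕ) + 1 := by
    exact_mod_cast h2
  rw [abs_le]
  constructor <;> linarith

/-- The angle which follows the trapezoidal profile before each visit to `Q`. -/
noncomputable def bump (Q : Set TwoShift) (L W : ℕ) (x : TwoShift) : ℝ :=
  ∑ j ∈ Finset.range (W + 1), trapezoid L W j * Q.indicator 1 (twoShiftMap^[j] x)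

theorem continuous_bump {Q : Set TwoShift} (hQ : IsClopen Q) (L W : ℕ) :
    Continuous (bump Q L W) := by
  unfold bump
  refine continuous_finsetSum _ fun j _ => continuous_const.mul ?_
  have : Continuous (Q.indicator (1 : TwoShift → ℝ)) :=
    (continuous_const (y := (1 : ℝ))).indicator (by simp [hQ.frontier_eq])
  exact this.comp (continuous_twoShiftMap.iterate j)

theorem bump_eq_zero {Q : Set TwoShift} {L W : ℕ} {x : TwoShift}
    (h : ∀ j ≤ W, twoShiftMap^[j] x ∉ Q) : bump Q L W x = 0 := by
  refine Finset.sum_eq_zero fun j hj => ?_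
  rw [Set.indicator_of_notMem (h j (by simpa [Nat.lt_succ_iff] using hj)), mul_zero]

variable {Q : Set TwoShift} {H L W n : ℕ}

theorem unique_visit (hQ : ∀ x ∈ Q, ∀ k, 0 < k → k < H → twoShiftMap^[k] x ∉ Q) {x : TwoShift}
    {i j : ℕ} (hi : i < H) (hj : j < H) (hxi : twoShiftMap^[i] x ∈ Q)
    (hxj : twoShiftMap^[j] x ∈ Q) : i = j := by
  wlog hij : i < j generalizing i j with h
  · rcases eq_or_lt_of_le (not_lt.1 hij) with h1 | h1
    · exact h1.symm
    · exact (h hj hi hxj hxi h1).symm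
  refine absurd ?_ (hQ _ hxi (j - i) (by omega) (by omega))
  rwa [← Function.iterate_add_apply, Nat.sub_add_cancel hij.le]

theorem bump_eq (hQ : ∀ x ∈ Q, ∀ k, 0 < k → k < H → twoShiftMap^[k] x ∉ Q) (hW : W < H)
    {x : TwoShift} {j : ℕ} (hj : j < H) (hx : twoShiftMap^[j] x ∈ Q) :
    bump Q L W x = trapezoid L W j := by
  by_cases hjW : j ≤ W
  · rw [bump, Finset.sum_eq_single j]
    · simp [hx]
    · intro i hi hij
      rw [Set.indicator_of_notMem, mul_zero]
      intro h
      exact hij (unique_visit hQ (by simp at hi; omega) hj h hx)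
    · intro h
      simp at h
      omega
  · rw [trapezoid_of_ge (by omega)]
    refine bump_eq_zero fun i hi h => ?_
    have := unique_visit hQ (by omega) hj h hx
    omega

/-- One step of the dynamics lowers the time remaining before the visit to `Q` by one; since visits
are more than `W + 1` apart, a single visit governs both values. -/
theorem bump_cases (hQ : ∀ x ∈ Q, ∀ k, 0 < k → k < H → twoShiftMap^[k] x ∉ Q) (hW : W + 1 < H)
    (x : TwoShift) :
    (bump Q L W x = 0 ∧ bump Q L W (twoShiftMap x) = 0) ∨
      ∃ j ≤ W, twoShiftMap^[j + 1] x ∈ Q ∧ bump Q L W x = trapezoid L W (j + 1) ∧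
        bump Q L W (twoShiftMap x) = trapezoid L W j := by
  by_cases h : ∃ j ≤ W, twoShiftMap^[j + 1] x ∈ Q
  · obtain ⟨j, hj, hx⟩ := h
    exact Or.inr ⟨j, hj, hx, bump_eq hQ (by omega) (by omega) hx,
      bump_eq hQ (by omega) (by omega) hx⟩
  · push Not at h
    have h1 : bump Q L W (twoShiftMap x) = 0 := bump_eq_zero h
    refine Or.inl ⟨?_, h1⟩
    by_cases h0 : x ∈ Q
    · rw [bump_eq (j := 0) hQ (by omega) (by omega) h0, trapezoid_zero]
    · refine bump_eq_zero fun j hj => ?_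
      cases j with
      | zero => exact h0
      | succ j => exact h j (by omega)

theorem abs_bump_sub_le (hQ : ∀ x ∈ Q, ∀ k, 0 < k → k < H → twoShiftMap^[k] x ∉ Q)
    (hW : W + 1 < H) (x : TwoShift) :
    |bump Q L W (twoShiftMap x) - bump Q L W x| ≤ Real.pi / 2 / L := by
  rcases bump_cases (L := L) hQ hW x with ⟨h1, h2⟩ | ⟨j, -, -, h1, h2⟩ <;> rw [h1, h2]
  · simp only [sub_zero, abs_zero]
    positivity
  · exact abs_trapezoid_sub_le L W j

/-- Points whose past contains two blocks of `L` zeros, at distance `n`. -/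
def zeroBlocks (L n : ℕ) : Set TwoShift :=
  {y | ∀ k < L, y (-1 - (k : ℤ)) = 0 ∧ y (-1 - (k : ℤ) - (n : ℤ)) = 0}

theorem isClopen_zeroBlocks (L n : ℕ) : IsClopen (zeroBlocks L n) := by
  have : zeroBlocks L n = ⋂ k ∈ Finset.range L,
      ({y : TwoShift | y (-1 - (k : ℤ)) = 0} ∩ {y : TwoShift | y (-1 - (k : ℤ) - (n : ℤ)) = 0}) := by
    ext y
    simp [zeroBlocks]
  rw [this]
  exact isClopen_biInter_finset fun k _ => (isClopen_coord_eq _ _).inter (isClopen_coord_eq _ _)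

/-- Turns recurrence of the fixed set `zeroBlocks L 0` into a lower bound, independent of `n`, for
the measure of `zeroBlocks L n`. -/
theorem preimage_zeroBlocks (L n : ℕ) :
    twoShiftMap^[n] ⁻¹' zeroBlocks L n = zeroBlocks L 0 ∩ twoShiftMap^[n] ⁻¹' zeroBlocks L 0 := by
  ext x
  simp only [zeroBlocks, Set.mem_preimage, Set.mem_ofPred_eq, twoShiftMap_iterate_apply,
    Set.mem_inter_iff, Nat.cast_zero, sub_zero, and_self, sub_add_cancel]
  rw [← forall₂_and]
  simp only [and_comm]

/-- Remaining times in `[1, L]` and `[n + 1, n + L]`, the two slopes of the trapezoid, fall inside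
the blocks of zeros, so a symbol `1` excludes them. -/
theorem mem_of_visit_zeroBlocks {x : TwoShift} {j : ℕ} (hx : x 0 = 1)
    (hj : twoShiftMap^[j] x ∈ zeroBlocks L n) :
    (j = 0 ∨ L < j) ∧ (j ≤ n ∨ n + L < j) := by
  have h0 : ∀ k : ℤ, k = 0 → x k ≠ 0 := by rintro _ rfl h; rw [hx] at h; simp at h
  constructor
  · by_contra! h
    have := (hj (j - 1) (by omega)).1
    rw [twoShiftMap_iterate_apply] at this
    exact h0 _ (by omega) this
  · by_contra! h
    have := (hj (j - 1 - n) (by omega)).2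
    rw [twoShiftMap_iterate_apply] at this
    exact h0 _ (by omega) this

/-- The profile varies only on its two slopes, which are read during blocks of zeros. At a symbol
`1` the step therefore lies on the plateau `π / 2` or where the profile is `0`. -/
theorem isPhase_bump (hQc : IsClopen Q) (hQb : Q ⊆ zeroBlocks L n) (hL : 0 < L)
    (hQ : ∀ x ∈ Q, ∀ k, 0 < k → k < H → twoShiftMap^[k] x ∉ Q) (hW : n + L + 1 < H) :
    IsPhase (bump Q L (n + L)) := by
  have key : ∀ x : TwoShift, x 0 = 1 →
      (bump Q L (n + L) x = 0 ∧ bump Q L (n + L) (twoShiftMap x) = 0) ∨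
      (bump Q L (n + L) x = Real.pi / 2 ∧ bump Q L (n + L) (twoShiftMap x) = Real.pi / 2) := by
    intro x hx
    rcases bump_cases (L := L) hQ hW x with h | ⟨j, hj, hxj, h1, h2⟩
    · exact Or.inl h
    · rw [h1, h2]
      obtain ⟨h3, h4⟩ := mem_of_visit_zeroBlocks hx (hQb hxj)
      rcases h4 with h4 | h4
      · right
        rw [trapezoid_of_mem hL (by omega) h4, trapezoid_of_mem hL (by omega) (by omega)]
        exact ⟨rfl, rfl⟩
      · left
        rw [trapezoid_of_ge h4.le, trapezoid_of_ge (by omega)]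
        exact ⟨rfl, rfl⟩
  refine ⟨continuous_bump hQc L _, fun x hx => ?_, fun x hx => ?_⟩
  · rcases key x hx with ⟨h, -⟩ | ⟨h, -⟩
    · exact ⟨0, by simp [h]⟩
    · exact ⟨1, by simp [h]⟩
  · rcases key x hx with ⟨h, h'⟩ | ⟨h, h'⟩ <;> rw [h, h']

/-- Before time `m` the profile has not started. From `m` to `n` it sits on the plateau, where
adding `π / 2` to the angle reverses the sign of the potential, or on a slope, where the potential
vanishes. The new sum is `S_m - (S_n - S_m)`. -/
theorem birkhoffSum_signedCoord_add_bump (hQb : Q ⊆ zeroBlocks L n) (hL : 0 < L)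
    (hQ : ∀ x ∈ Q, ∀ k, 0 < k → k < H → twoShiftMap^[k] x ∉ Q) {m : ℕ} (hm : m ≤ n)
    (hW : n + L + m < H) (Φ : TwoShift → ℝ) {x : TwoShift}
    (hx : twoShiftMap^[n + L + m] x ∈ Q) :
    birkhoffSum twoShiftMap (signedCoord fun y => Φ y + bump Q L (n + L) y) n x =
      2 * birkhoffSum twoShiftMap (signedCoord Φ) m x -
        birkhoffSum twoShiftMap (signedCoord Φ) n x := by
  have hvisit : ∀ t ≤ n + L + m, twoShiftMap^[n + L + m - t] (twoShiftMap^[t] x) ∈ Q := by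
    intro t ht
    rwa [← Function.iterate_add_apply, Nat.sub_add_cancel ht]
  have h1 : ∀ t < m, signedCoord (fun y => Φ y + bump Q L (n + L) y) (twoShiftMap^[t] x) =
      signedCoord Φ (twoShiftMap^[t] x) := by
    intro t ht
    have h := hvisit t (by omega)
    rw [signedCoord, bump_eq hQ (by omega) (by omega) h, trapezoid_of_ge (by omega), add_zero,
      signedCoord]
  have h2 : ∀ t, m ≤ t → t < n →
      signedCoord (fun y => Φ y + bump Q L (n + L) y) (twoShiftMap^[t] x) =
      - signedCoord Φ (twoShiftMap^[t] x) := by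
    intro t hmt ht
    by_cases hx1 : twoShiftMap^[t] x 0 = 1
    · have h := hvisit t (by omega)
      obtain ⟨h3, h4⟩ := mem_of_visit_zeroBlocks hx1 (hQb h)
      rw [signedCoord, bump_eq hQ (by omega) (by omega) h,
        trapezoid_of_mem hL (by omega) (by omega), signedCoord, mul_add,
        mul_div_cancel₀ _ (two_ne_zero' ℝ), Real.cos_add_pi, mul_neg]
    · rw [signedCoord_of_ne hx1, signedCoord_of_ne hx1, neg_zero]
  obtain ⟨d, rfl⟩ := Nat.exists_eq_add_of_le hm
  unfold birkhoffSum
  rw [Finset.sum_range_add, Finset.sum_range_add,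
    Finset.sum_congr rfl fun t ht => h1 t (Finset.mem_range.1 ht),
    Finset.sum_congr rfl fun t ht => h2 (m + t) (by omega)
      (by have := Finset.mem_range.1 ht; omega), Finset.sum_neg_distrib]
  ring

end Phase

/-! ### One stage of the construction -/

section Stage

variable {μ : Measure TwoShift} {Q : Set TwoShift} {H : ℕ}

theorem measureReal_iUnion_visits [IsProbabilityMeasure μ]
    (hμ : MeasurePreserving twoShiftMap μ μ) (hQm : MeasurableSet Q)
    (hQ : ∀ x ∈ Q, ∀ k, 0 < k → k < H → twoShiftMap^[k] x ∉ Q) {s : Finset ℕ}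
    (hs : ∀ i ∈ s, i < H) :
    μ.real (⋃ i ∈ s, twoShiftMap^[i] ⁻¹' Q) = s.card * μ.real Q := by
  rw [measureReal_biUnion_finset]
  · simp [hμ.measureReal_iterate_preimage hQm]
  · intro i hi j hj hij
    refine Set.disjoint_left.2 fun x hxi hxj => hij ?_
    exact unique_visit hQ (hs i hi) (hs j hj) hxi hxj
  · exact fun i _ => (hμ.measurable.iterate i) hQm

theorem measureReal_bump_ne_zero_le [IsProbabilityMeasure μ]
    (hμ : MeasurePreserving twoShiftMap μ μ) (hQm : MeasurableSet Q) (L W : ℕ) :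
    μ.real {x | bump Q L W x ≠ 0} ≤ (W + 1) * μ.real Q := by
  have hsub : {x | bump Q L W x ≠ 0} ⊆
      ⋃ j ∈ Finset.range (W + 1), twoShiftMap^[j] ⁻¹' Q := by
    intro x hx
    by_contra h
    simp only [Set.mem_iUnion, Finset.mem_range, Set.mem_preimage, not_exists] at h
    exact hx (bump_eq_zero fun j hj => h j (by omega))
  refine (measureReal_mono hsub (measure_ne_top _ _)).trans ((measureReal_biUnion_finset_le _ _).trans ?_)
  simp [hμ.measureReal_iterate_preimage hQm]

theorem abs_integral_signedCoord_le [IsProbabilityMeasure μ] (Φ : TwoShift → ℝ) :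
    |∫ x, signedCoord Φ x ∂μ| ≤ 1 := by
  have := norm_integral_le_of_norm_le_const (μ := μ) (f := signedCoord Φ) (C := 1)
    (ae_of_all _ (abs_signedCoord_le Φ))
  simpa using this

/-- A small perturbation, supported on a set of small measure, can create a Birkhoff sum of small
size at a late time with probability much larger than prescribed. -/
theorem exists_isPhase_large_deviation [IsProbabilityMeasure μ] [μ.IsOpenPosMeasure]
    (hμ : Ergodic twoShiftMap μ) {u : ℕ → ℝ} (hu : Tendsto u atTop (𝓝 0)) {Φ : TwoShift → ℝ}
    (hΦ : Measurable Φ) {a δ : ℝ} (ha : 0 < a) (hδ : 0 < δ) (N : ℕ) :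
    ∃ (ψ : TwoShift → ℝ) (n : ℕ), IsPhase ψ ∧ (∀ x, |ψ (twoShiftMap x) - ψ x| ≤ δ) ∧
      μ.real {x | ψ x ≠ 0} ≤ δ ∧ N ≤ n ∧
      2 * u n ≤ μ.real
        {x | |birkhoffSum twoShiftMap (signedCoord fun y => Φ y + ψ y) n x| ≤ n * a} := by
  have hmp := hμ.toMeasurePreserving
  obtain ⟨L, hL⟩ := exists_nat_gt (Real.pi / 2 / δ)
  have hL0' : (0 : ℝ) < L := lt_trans (by positivity) hL
  have hL0 : 0 < L := by exact_mod_cast hL0'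
  have hLδ : Real.pi / 2 / L ≤ δ := by
    rw [div_lt_iff₀ hδ] at hL
    rw [div_le_iff₀ hL0']
    linarith
  -- The sign change will occur within `v = n / (2 s)` steps of time `n / 2`; this `s` keeps the
  -- resulting imbalance `2 v` at most `n a / 2`.
  obtain ⟨s, hs⟩ := exists_nat_gt (2 / a + 2)
  have hs2' : (2 : ℝ) < s := lt_trans (by simpa using div_pos two_pos ha) hs
  have hs2 : 2 < s := by exact_mod_cast hs2'
  have hsa : 2 ≤ a * s := by
    have : 2 / a < s := by linarith
    rw [div_lt_iff₀ ha] at this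
    linarith
  -- With visits separated by `H = K n`, the bump lives on a set of measure at most `2 n / H = 2 / K
  -- ≤ δ`.
  obtain ⟨K, hK⟩ := exists_nat_gt (2 / δ + 3)
  have hK3' : (3 : ℝ) < K := lt_trans (by simpa using div_pos two_pos hδ) hK
  have hK3 : 3 < K := by exact_mod_cast hK3'
  have hKδ : 2 ≤ δ * K := by
    have : 2 / δ < K := by linarith
    rw [div_lt_iff₀ hδ] at this
    linarith
  have hZ := isClopen_zeroBlocks L 0
  have hZpos : 0 < μ.real (zeroBlocks L 0) :=
    ENNReal.toReal_pos (hZ.2.measure_ne_zero μ ⟨fun _ => 0, by simp [zeroBlocks]⟩)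
      (measure_ne_top _ _)
  obtain ⟨c, hc, hrec⟩ := hmp.exists_le_measureReal_inter_preimage hZ.2.measurableSet hZpos
  -- Lower bound for `v * μ.real Q`, from `μ.real Q ≥ c / (2 H)` and `H = K * (2 s v)`; it does not
  -- involve `n`. Half of it will be lost to points with atypical Birkhoff sums, and `u n ≤ p / 4`
  -- suffices for the rest.
  set p : ℝ := c / (4 * K * s) with hp
  have hp0 : 0 < p := by positivity
  set f := signedCoord Φ with hf
  have hfm : Measurable f := measurable_signedCoord hΦ
  set lam := ∫ x, f x ∂μ with hlam
  have hlam1 : |lam| ≤ 1 := abs_integral_signedCoord_le Φ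
  have hSm : ∀ m, Measurable (birkhoffSum twoShiftMap f m) := fun m =>
    measurable_birkhoffSum hμ.measurable hfm m
  obtain ⟨N₀, hN₀⟩ := exists_measureReal_iUnion_ge_le (μ := μ)
    (B := fun m : ℕ => {x | a / 4 * m < |birkhoffSum twoShiftMap f m x - m * lam|})
    (fun m => measurableSet_lt measurable_const ((hSm m).sub measurable_const).abs) (by
      filter_upwards [hμ.ae_tendsto_birkhoffSum_div hfm (abs_signedCoord_le Φ)] with x hx
      have h1 := (Metric.tendsto_atTop.1 hx) (a / 4) (by positivity)
      obtain ⟨M, hM⟩ := h1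
      filter_upwards [eventually_ge_atTop M, eventually_gt_atTop 0] with m hm hm0
      have hm0' : (0 : ℝ) < m := by exact_mod_cast hm0
      have h2 := hM m hm
      rw [Real.dist_eq, div_sub' hm0'.ne', abs_div, abs_of_pos hm0', div_lt_iff₀ hm0'] at h2
      rw [not_lt]
      exact h2.le) (p := p / 2) (by positivity)
  obtain ⟨N₁, hN₁⟩ := eventually_atTop.1 (hu.eventually_le_const (by positivity : (0 : ℝ) < p / 4))
  -- Recurrence is applied along multiples of `2 s w`, so that `n = 2 s v` with `v ≥ w` beyond every
  -- threshold.
  set w := N + N₀ + N₁ + L + 2 with hw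
  obtain ⟨v₀, hv₀, hv₀c⟩ := hrec (2 * s * w)
  set v := v₀ * w with hv
  have hwv : w ≤ v := Nat.le_mul_of_pos_left _ hv₀
  set n := 2 * (s * v) with hn
  have hnv : v₀ * (2 * s * w) = n := by rw [hn, hv]; ring
  rw [hnv] at hv₀c
  have hvsv : 2 * v ≤ s * v := Nat.mul_le_mul_right _ hs2.le
  have hvn : v ≤ n := by omega
  have hv0 : 0 < v := by omega
  have hn0 : 0 < n := by omega
  have hn0' : (0 : ℝ) < n := by exact_mod_cast hn0
  have hCc := isClopen_zeroBlocks L n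
  have hCm : c ≤ μ.real (zeroBlocks L n) := by
    rw [← hmp.measureReal_iterate_preimage hCc.2.measurableSet n, preimage_zeroBlocks]
    exact hv₀c
  have hHpos : 0 < K * n := Nat.mul_pos (by omega) hn0
  have hHn : 4 * n ≤ K * n := Nat.mul_le_mul_right _ hK3
  obtain ⟨Q, hQC, hQc, hQ, hQm⟩ := hμ.exists_isClopen_separated continuous_twoShiftMap
    (exists_isClopen_measureReal_lt μ) hCc (hc.trans_le hCm) hHpos
  set H := K * n with hH
  have hW : n + L + 1 < H := by omega
  have hQ1 : H * μ.real Q ≤ 1 := by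
    have h := measureReal_iUnion_visits hmp hQc.2.measurableSet hQ (s := Finset.range H)
      (fun i hi => Finset.mem_range.1 hi)
    rw [Finset.card_range] at h
    rw [← h]
    exact measureReal_le_one
  refine ⟨bump Q L (n + L), n, isPhase_bump hQc hQC hL0 hQ hW,
    fun x => (abs_bump_sub_le hQ hW x).trans hLδ, ?_, by omega, ?_⟩
  · refine (measureReal_bump_ne_zero_le hmp hQc.2.measurableSet L (n + L)).trans ?_
    have h1 : ((n + L : ℕ) : ℝ) + 1 ≤ 2 * n := by exact_mod_cast (by omega : n + L + 1 ≤ 2 * n)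
    have h2 : (0 : ℝ) ≤ μ.real Q := measureReal_nonneg
    calc (((n + L : ℕ) : ℝ) + 1) * μ.real Q ≤ 2 * n * μ.real Q := by gcongr
      _ ≤ δ * K * n * μ.real Q := by gcongr
      _ = δ * (H * μ.real Q) := by rw [hH]; push_cast; ring
      _ ≤ δ := mul_le_of_le_one_right hδ.le hQ1
  -- The `v` visit times `n + L + m` with `s v - v ≤ m < s v`, that is, with the sign change just
  -- before time `n / 2`; separation makes the corresponding events disjoint.
  · set S : Finset ℕ := Finset.Ico (n + L + (s * v - v)) (n + L + s * v) with hS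
    set D := ⋃ n, ⋃ _ : N₀ ≤ n, {x | a / 4 * n < |birkhoffSum twoShiftMap f n x - n * lam|}
      with hD
    have hsub : (⋃ i ∈ S, twoShiftMap^[i] ⁻¹' Q) ⊆
        {x | |birkhoffSum twoShiftMap (signedCoord fun y => Φ y + bump Q L (n + L) y) n x| ≤
          n * a} ∪ D := by
      intro x hx
      by_cases hxD : x ∈ D
      · exact Or.inr hxD
      left
      simp only [Set.mem_iUnion, hS, Finset.mem_Ico, exists_prop] at hx
      obtain ⟨i, ⟨hi1, hi2⟩, hxi⟩ := hx
      obtain ⟨m, rfl⟩ := Nat.exists_eq_add_of_le (show n + L ≤ i by omega)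
      have hm1 : s * v ≤ m + v := by omega
      have hm2 : m < s * v := by omega
      have hgood : ∀ k : ℕ, N₀ ≤ k → |birkhoffSum twoShiftMap f k x - k * lam| ≤ a / 4 * k := by
        intro k hk
        by_contra h
        exact hxD (Set.mem_iUnion.2 ⟨k, Set.mem_iUnion.2 ⟨hk, not_le.1 h⟩⟩)
      have hgm := abs_le.1 (hgood m (by omega))
      have hgn := abs_le.1 (hgood n (by omega))
      rw [Set.mem_ofPred_eq, birkhoffSum_signedCoord_add_bump hQC hL0 hQ (m := m) (by omega)
        (by omega) Φ hxi]
      have e1 : (n : ℝ) = 2 * (s * v) := by rw [hn]; push_cast; ring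
      have e2 : (s : ℝ) * v ≤ m + v := by exact_mod_cast hm1
      have e3 : (m : ℝ) ≤ s * v := by exact_mod_cast hm2.le
      have e4 : 2 * (v : ℝ) ≤ a * s * v := by gcongr
      -- Error budget for `|2 S_m - S_n|`: `n a / 4` from `2 S_m`, `n a / 4` from `S_n`, and `n a /
      -- 2` from the drift `(2 m - n) * lam`.
      have hd := abs_le.1 (show |((n : ℝ) - 2 * m) * lam| ≤ 2 * v * 1 by
        rw [abs_mul]
        refine mul_le_mul ?_ hlam1 (abs_nonneg _) (by positivity)
        rw [abs_le]
        constructor <;> linarith)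
      have e5 : a * m ≤ a * (s * v) := by gcongr
      have e6 : n * a = 2 * (a * s * v) := by rw [e1]; ring
      have e7 : a / 4 * n = a * s * v / 2 := by rw [e1]; ring
      rw [e7] at hgn
      rw [e6, ← hf, abs_le]
      constructor <;> linarith
    have h1 := measureReal_iUnion_visits hmp hQc.2.measurableSet hQ (s := S)
      (fun i hi => by simp only [hS, Finset.mem_Ico] at hi; omega)
    have hcard : S.card = v := by rw [hS, Nat.card_Ico]; omega
    rw [hcard] at h1
    have h2 := (measureReal_mono (μ := μ) hsub).trans (measureReal_union_le _ _)
    rw [h1] at h2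
    have h3 : p ≤ v * μ.real Q := by
      rw [hp, div_le_iff₀ (by positivity)]
      have h4 : (H : ℝ) = K * (2 * (s * v)) := by rw [hH, hn]; push_cast; ring
      rw [h4] at hQm
      linarith
    have h5 := hN₁ n (by omega)
    linarith

end Stage

/-! ### Rotations, diagonal matrices and norms of conjugated cocycles -/

section Matrices

/-- The rotation of angle `θ`. -/
noncomputable def slRot (θ : ℝ) : Matrix.SpecialLinearGroup (Fin 2) ℝ :=
  ⟨!![Real.cos θ, -Real.sin θ; Real.sin θ, Real.cos θ], by
    rw [Matrix.det_fin_two_of]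
    linarith [Real.sin_sq_add_cos_sq θ]⟩

/-- The diagonal matrix with entries `exp s` and `exp (-s)`. -/
noncomputable def slDiag (s : ℝ) : Matrix.SpecialLinearGroup (Fin 2) ℝ :=
  ⟨!![Real.exp s, 0; 0, Real.exp (-s)], by
    rw [Matrix.det_fin_two_of, ← Real.exp_add]
    simp⟩

theorem coe_slRot (θ : ℝ) : (slRot θ : Matrix (Fin 2) (Fin 2) ℝ) =
    !![Real.cos θ, -Real.sin θ; Real.sin θ, Real.cos θ] := rfl

theorem coe_slDiag (s : ℝ) : (slDiag s : Matrix (Fin 2) (Fin 2) ℝ) =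
    !![Real.exp s, 0; 0, Real.exp (-s)] := rfl

theorem slRot_add (a b : ℝ) : slRot (a + b) = slRot a * slRot b := by
  refine Subtype.ext ?_
  rw [Matrix.SpecialLinearGroup.coe_mul, coe_slRot, coe_slRot, coe_slRot, Matrix.mul_fin_two,
    Real.cos_add, Real.sin_add]
  ext i j
  fin_cases i <;> fin_cases j <;> simp <;> ring

theorem slDiag_add (a b : ℝ) : slDiag (a + b) = slDiag a * slDiag b := by
  refine Subtype.ext ?_
  rw [Matrix.SpecialLinearGroup.coe_mul, coe_slDiag, coe_slDiag, coe_slDiag, Matrix.mul_fin_two,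
    neg_add, Real.exp_add, Real.exp_add]
  simp

theorem slRot_zero : slRot 0 = 1 := by
  ext i j
  fin_cases i <;> fin_cases j <;> simp [slRot]

theorem slDiag_zero : slDiag 0 = 1 := by
  ext i j
  fin_cases i <;> fin_cases j <;> simp [slDiag]

theorem slRot_neg_mul_slRot (a : ℝ) : slRot (-a) * slRot a = 1 := by
  rw [← slRot_add, neg_add_cancel, slRot_zero]

/-- An even multiple of `π / 2` preserves each axis and has `cos 2θ = 1`; an odd one exchanges the
axes and has `cos 2θ = -1`, and the two effects cancel. -/
theorem slRot_mul_slDiag_mul_slRot_neg {θ : ℝ} (h : ∃ k : ℤ, θ = k * (Real.pi / 2)) :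
    slRot θ * slDiag (Real.cos (2 * θ)) * slRot (-θ) = slDiag 1 := by
  obtain ⟨k, hk⟩ := h
  have h0 : Real.sin θ * Real.cos θ = 0 := by
    have h1 : Real.sin (2 * θ) = 0 := by
      rw [hk, ← Real.sin_int_mul_pi k]
      congr 1
      ring
    rw [Real.sin_two_mul] at h1
    linarith
  have h2 := Real.sin_sq_add_cos_sq θ
  refine Subtype.ext ?_
  rw [Matrix.SpecialLinearGroup.coe_mul, Matrix.SpecialLinearGroup.coe_mul, coe_slRot, coe_slDiag,
    coe_slRot, coe_slDiag, Matrix.mul_fin_two, Matrix.mul_fin_two, Real.cos_neg, Real.sin_neg,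
    Real.cos_two_mul]
  rcases mul_eq_zero.1 h0 with h3 | h3
  · have h4 : Real.cos θ ^ 2 = 1 := by rw [h3] at h2; linarith
    have h5 : (2 * 1 - 1 : ℝ) = 1 := by norm_num
    rw [h4, h3, h5]
    ext i j
    fin_cases i <;> fin_cases j <;> simp
    · linear_combination Real.exp 1 * h4
    · linear_combination (Real.exp (-1)) * h4
  · have h4 : Real.sin θ ^ 2 = 1 := by rw [h3] at h2; linarith
    have h5 : (2 * 0 ^ 2 - 1 : ℝ) = -1 := by norm_num
    rw [h3, h5]
    ext i j
    fin_cases i <;> fin_cases j <;> simp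
    · linear_combination Real.exp 1 * h4
    · linear_combination (Real.exp (-1)) * h4

theorem continuous_slRot : Continuous slRot := by
  refine continuous_induced_rng.2 (continuous_matrix fun i j => ?_)
  fin_cases i <;> fin_cases j <;> simp <;> fun_prop

section

open scoped Matrix.Norms.L2Operator

theorem slNorm_eq (A : Matrix.SpecialLinearGroup (Fin 2) ℝ) :
    slNorm A = ‖(A : Matrix (Fin 2) (Fin 2) ℝ)‖ := rfl

theorem slRot_mem_unitary (θ : ℝ) :
    (slRot θ : Matrix (Fin 2) (Fin 2) ℝ) ∈ unitary (Matrix (Fin 2) (Fin 2) ℝ) := by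
  have h := Real.sin_sq_add_cos_sq θ
  rw [← Matrix.unitaryGroup, Matrix.mem_unitaryGroup_iff']
  ext i j
  fin_cases i <;> fin_cases j <;>
    simp [slRot, Matrix.mul_apply, Fin.sum_univ_two, Matrix.star_apply] <;> linarith

theorem slNorm_slRot_mul_slDiag_mul_slRot (a b s : ℝ) :
    slNorm (slRot a * slDiag s * slRot b) = Real.exp |s| := by
  rw [slNorm_eq, Matrix.SpecialLinearGroup.coe_mul, Matrix.SpecialLinearGroup.coe_mul,
    CStarRing.norm_mul_mem_unitary _ (slRot_mem_unitary b),
    CStarRing.norm_mem_unitary_mul _ (slRot_mem_unitary a)]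
  have : (slDiag s : Matrix (Fin 2) (Fin 2) ℝ) =
      Matrix.diagonal ![Real.exp s, Real.exp (-s)] := by
    ext i j
    fin_cases i <;> fin_cases j <;> simp [slDiag]
  rw [this, Matrix.l2_opNorm_diagonal]
  refine le_antisymm ((pi_norm_le_iff_of_nonneg (Real.exp_pos _).le).2 fun i => ?_) ?_
  · fin_cases i
    · simpa using le_abs_self s
    · simpa using neg_le_abs s
  · rcases abs_cases s with ⟨h, -⟩ | ⟨h, -⟩ <;> rw [h]
    · simpa using norm_le_pi_norm ![Real.exp s, Real.exp (-s)] 0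
    · simpa using norm_le_pi_norm ![Real.exp s, Real.exp (-s)] 1

end

/-- The inner rotations telescope. Only the orbit of `x` enters, so the conjugacy need hold only
almost everywhere. -/
theorem cocycleIter_eq_of_conj {X : Type*} {T : X → X}
    {M : X → Matrix.SpecialLinearGroup (Fin 2) ℝ} {θ φ : X → ℝ} {x : X}
    (h : ∀ t : ℕ, M (T^[t] x) =
      slRot (θ (T^[t + 1] x)) * slDiag (φ (T^[t] x)) * slRot (-θ (T^[t] x))) (n : ℕ) :
    cocycleIter T M n x = slRot (θ (T^[n] x)) * slDiag (birkhoffSum T φ n x) * slRot (-θ x) := by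
  induction n with
  | zero => simp [cocycleIter, slDiag_zero, ← slRot_add, slRot_zero]
  | succ n ih =>
    rw [cocycleIter, ih, h n, birkhoffSum_succ, add_comm (birkhoffSum T φ n x), slDiag_add]
    calc _ = slRot (θ (T^[n + 1] x)) * slDiag (φ (T^[n] x)) *
          (slRot (-θ (T^[n] x)) * slRot (θ (T^[n] x))) * slDiag (birkhoffSum T φ n x) *
            slRot (-θ x) := by simp only [mul_assoc]
      _ = _ := by rw [slRot_neg_mul_slRot, mul_one]; simp only [mul_assoc]

theorem logNormIter_eq_of_conj {X : Type*} {T : X → X}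
    {M : X → Matrix.SpecialLinearGroup (Fin 2) ℝ} {θ φ : X → ℝ} {x : X}
    (h : ∀ t : ℕ, M (T^[t] x) =
      slRot (θ (T^[t + 1] x)) * slDiag (φ (T^[t] x)) * slRot (-θ (T^[t] x))) (n : ℕ) :
    logNormIter T M n x = |birkhoffSum T φ n x| := by
  rw [logNormIter, cocycleIter_eq_of_conj h, slNorm_slRot_mul_slDiag_mul_slRot, Real.log_exp]

end Matrices

/-! ### Summing the perturbations -/

section Summation

theorem le_geometric_of_halving {δ : ℕ → ℝ} (hδ : ∀ i, δ (i + 1) ≤ δ i / 2) (k j : ℕ) :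
    δ (j + k) ≤ δ k * (1 / 2) ^ j := by
  induction j with
  | zero => simp
  | succ j ih =>
    have h := hδ (j + k)
    rw [show j + 1 + k = j + k + 1 by omega, pow_succ]
    linarith

theorem tsum_measure_le_of_halving {X : Type*} [MeasurableSpace X] {μ : Measure X}
    [IsFiniteMeasure μ] {δ : ℕ → ℝ} (hδ : ∀ i, δ (i + 1) ≤ δ i / 2) (hpos : ∀ i, 0 < δ i)
    {s : ℕ → Set X} (hs : ∀ i, μ.real (s i) ≤ δ i) (k : ℕ) :
    ∑' j, μ (s (j + k)) ≤ ENNReal.ofReal (2 * δ k) := by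
  have hsum : HasSum (fun j : ℕ => δ k * (1 / 2) ^ j) (δ k * 2) := hasSum_geometric_two.mul_left _
  calc ∑' j, μ (s (j + k)) ≤ ∑' j : ℕ, ENNReal.ofReal (δ k * (1 / 2) ^ j) := by
        refine ENNReal.tsum_le_tsum fun j => ?_
        refine ENNReal.le_ofReal_iff_toReal_le (measure_ne_top _ _) ?_ |>.2 ?_
        · exact mul_nonneg (hpos k).le (by positivity)
        · exact (hs _).trans (le_geometric_of_halving hδ k j)
    _ = ENNReal.ofReal (2 * δ k) := by
        rw [← ENNReal.ofReal_tsum_of_nonneg (fun j => mul_nonneg (hpos k).le (by positivity))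
          hsum.summable, hsum.tsum_eq, mul_comm]

theorem measureReal_iUnion_le_of_halving {X : Type*} [MeasurableSpace X] {μ : Measure X}
    [IsFiniteMeasure μ] {δ : ℕ → ℝ} (hδ : ∀ i, δ (i + 1) ≤ δ i / 2) (hpos : ∀ i, 0 < δ i)
    {s : ℕ → Set X} (hs : ∀ i, μ.real (s i) ≤ δ i) (k : ℕ) :
    μ.real (⋃ j, s (j + k)) ≤ 2 * δ k :=
  ENNReal.toReal_le_of_le_ofReal (by linarith [hpos k])
    ((measure_iUnion_le _).trans (tsum_measure_le_of_halving hδ hpos hs k))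

theorem IsPhase.sum {ψ : ℕ → TwoShift → ℝ} (h : ∀ i, IsPhase (ψ i)) (K : ℕ) :
    IsPhase fun x => ∑ j ∈ Finset.range K, ψ j x := by
  induction K with
  | zero => simpa using IsPhase.zero
  | succ K ih => simpa only [Finset.sum_range_succ] using ih.add (h K)

end Summation

/-! ### Inductive construction and conclusion -/

/-- Iterating the perturbation lemma, with errors small enough not to destroy the large
deviations obtained at the previous stages. -/
theorem exists_seq_isPhase (μ : Measure TwoShift) [IsProbabilityMeasure μ] [μ.IsOpenPosMeasure]
    (hμ : Ergodic twoShiftMap μ) {u : ℕ → ℝ} (hu_pos : ∀ n, 0 < u n)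
    (hu : Tendsto u atTop (𝓝 0)) {a δ₀ : ℝ} (ha : 0 < a) (hδ₀ : 0 < δ₀) :
    ∃ (ψ : ℕ → TwoShift → ℝ) (δ : ℕ → ℝ) (n : ℕ → ℕ), δ 0 = δ₀ ∧ ∀ i, 0 < δ i ∧
      δ (i + 1) ≤ δ i / 2 ∧ n i * (2 * δ (i + 1)) ≤ u (n i) ∧ IsPhase (ψ i) ∧
      (∀ x, |ψ i (twoShiftMap x) - ψ i x| ≤ δ i) ∧ μ.real {x | ψ i x ≠ 0} ≤ δ i ∧ i ≤ n i ∧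
      2 * u (n i) ≤ μ.real {x | |birkhoffSum twoShiftMap
        (signedCoord fun y => ∑ j ∈ Finset.range (i + 1), ψ j y) (n i) x| ≤ n i * a} := by
  have hstep : ∀ (s : {Φ : TwoShift → ℝ // Measurable Φ} × {δ : ℝ // 0 < δ}) (N : ℕ),
      ∃ (ψ : TwoShift → ℝ) (n : ℕ), IsPhase ψ ∧ (∀ x, |ψ (twoShiftMap x) - ψ x| ≤ s.2.1) ∧
      μ.real {x | ψ x ≠ 0} ≤ s.2.1 ∧ N ≤ n ∧
      2 * u n ≤ μ.real
        {x | |birkhoffSum twoShiftMap (signedCoord fun y => s.1.1 y + ψ y) n x| ≤ n * a} :=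
    fun s N => exists_isPhase_large_deviation hμ hu s.1.2 ha s.2.2 N
  choose ψ n hψ hω hm hN hdev using hstep
  -- The state is the angle built so far and the size allowed next. The second term of the minimum
  -- bounds by `u (n i)` the probability that later stages, supported on a set of measure at most `2
  -- δ (i + 1)`, affect the first `n i` steps.
  let st : ℕ → {Φ : TwoShift → ℝ // Measurable Φ} × {δ : ℝ // 0 < δ} := fun i =>
    Nat.rec (⟨fun _ => 0, measurable_const⟩, ⟨δ₀, hδ₀⟩)
      (fun i s => (⟨fun y => s.1.1 y + ψ s i y, s.1.2.add (hψ s i).continuous.measurable⟩,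
        ⟨min (s.2.1 / 2) (u (n s i) / (2 * (n s i + 1))),
          lt_min (half_pos s.2.2) (div_pos (hu_pos _) (by positivity))⟩)) i
  have hst1 : ∀ i, (st (i + 1)).1.1 = fun y => (st i).1.1 y + ψ (st i) i y := fun i => rfl
  have hst2 : ∀ i, (st (i + 1)).2.1 =
      min ((st i).2.1 / 2) (u (n (st i) i) / (2 * (n (st i) i + 1))) := fun i => rfl
  have hsum : ∀ i, (st i).1.1 = fun y => ∑ j ∈ Finset.range i, ψ (st j) j y := by
    intro i
    induction i with
    | zero => simp [st]
    | succ i ih => rw [hst1, ih]; simp only [Finset.sum_range_succ]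
  refine ⟨fun i => ψ (st i) i, fun i => (st i).2.1, fun i => n (st i) i, rfl, fun i =>
    ⟨(st i).2.2, ?_, ?_, hψ _ _, hω _ _, hm _ _, hN _ _, ?_⟩⟩
  · exact (hst2 i).trans_le (min_le_left _ _)
  · have h1 : (st (i + 1)).2.1 ≤ u (n (st i) i) / (2 * (n (st i) i + 1)) := by
      rw [hst2]
      exact min_le_right _ _
    rw [le_div_iff₀ (by positivity)] at h1
    have h2 := (st (i + 1)).2.2
    simp only
    nlinarith
  · have := hdev (st i) i
    rw [← hst1, congrArg signedCoord (hsum (i + 1))] at this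
    exact this

/-- Subexponential lower bounds on the probability of a deviation contradict exponential large
deviations. -/
theorem not_hasExpLargeDeviations_of_frequently {X : Type*} [MeasurableSpace X] {μ : Measure X}
    {f : ℕ → X → ℝ} {lam : ℝ} (hlam : 0 < lam) {u : ℕ → ℝ}
    (hfreq : ∃ᶠ n : ℕ in atTop, ENNReal.ofReal (u n) ≤ μ {x | f n x ≤ n * lam / 2})
    (hu : ∀ c : ℝ, 0 < c → Tendsto (fun n : ℕ => u n * Real.exp (c * n)) atTop atTop) :
    ¬ HasExpLargeDeviations μ f lam := by
  intro h
  obtain ⟨C, hC, hb⟩ := h (lam / 2) (by positivity)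
  obtain ⟨n, hn, hn'⟩ := (hfreq.and_eventually
    ((hu C⁻¹ (by positivity)).eventually_gt_atTop C)).exists
  have hsub : {x | f n x ≤ n * lam / 2} ⊆ {x | |f n x - n * lam| ≥ n * (lam / 2)} := by
    intro x hx
    have hx' : f n x ≤ n * lam / 2 := hx
    change (n : ℝ) * (lam / 2) ≤ |f n x - n * lam|
    refine le_trans ?_ (neg_le_abs _)
    linarith
  have h1 := (hn.trans (measure_mono hsub)).trans (hb n)
  rw [ENNReal.ofReal_le_ofReal_iff (by positivity), Real.exp_neg] at h1
  have h2 : u n * Real.exp (C⁻¹ * n) ≤ C := by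
    rw [← div_eq_mul_inv, le_div_iff₀ (Real.exp_pos _)] at h1
    exact h1
  linarith

theorem theoremA3 (μ : Measure TwoShift) [IsProbabilityMeasure μ] [μ.IsOpenPosMeasure]
    (hμ : Ergodic twoShiftMap μ)
    (u : ℕ → ℝ) (hu_pos : ∀ n, 0 < u n) (hu_lim : Tendsto u atTop (𝓝 0)) :
    ∃ (M : TwoShift → Matrix.SpecialLinearGroup (Fin 2) ℝ) (lam : ℝ),
      Continuous M ∧
      IsTopLyapunovExponent twoShiftMap μ M lam ∧
      0 < lam ∧
      (∃ᶠ n : ℕ in atTop,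
        ENNReal.ofReal (u n) ≤ μ {x | logNormIter twoShiftMap M n x ≤ n * lam / 2}) ∧
      ((∀ c : ℝ, 0 < c → Tendsto (fun n : ℕ => u n * Real.exp (c * n)) atTop atTop) →
        ¬ HasExpLargeDeviations μ (logNormIter twoShiftMap M) lam) := by
  have hmp := hμ.toMeasurePreserving
  set α : ℝ := μ.real {x : TwoShift | x 0 = 1} with hα
  have hαpos : 0 < α := ENNReal.toReal_pos
    ((isClopen_coord_eq 0 1).2.measure_ne_zero μ ⟨fun _ => 1, rfl⟩) (measure_ne_top _ _)
  -- `δ 0 = α / 8` yields exponent at least `α / 2`; then the threshold `n * (α / 4)` is at most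
  -- half the exponent times `n`.
  obtain ⟨ψ, δ, n, hδ0, hseq⟩ := exists_seq_isPhase μ hμ hu_pos hu_lim
    (show 0 < α / 4 by positivity) (show 0 < α / 8 by positivity)
  choose hδpos hδhalf hnδ hψ hω hψm hn hdev using hseq
  set θ : TwoShift → ℝ := fun x => ∑' j, ψ j x with hθ
  set ω : TwoShift → ℝ := fun x => ∑' j, (ψ j (twoShiftMap x) - ψ j x) with hωdef
  set M : TwoShift → Matrix.SpecialLinearGroup (Fin 2) ℝ := fun x =>
    slRot (ω x) * slDiag ((x 0 : Fin 2) : ℕ) with hM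
  -- The `ψ j` need not be small in sup norm, so `θ` need not be continuous; only their increments
  -- along the shift are uniformly summable.
  have hωc : Continuous ω := by
    refine continuous_tsum (u := fun j => δ 0 * (1 / 2) ^ j)
      (fun j => ((hψ j).continuous.comp continuous_twoShiftMap).sub (hψ j).continuous)
      (summable_geometric_two.mul_left _) fun j x => ?_
    exact (hω j x).trans (le_geometric_of_halving hδhalf 0 j)
  have hMc : Continuous M := by
    refine (continuous_slRot.comp hωc).mul ?_
    exact (continuous_of_discreteTopology (f := fun a : Fin 2 => slDiag ((a : ℕ) : ℝ))).comp
      (continuous_apply (0 : ℤ))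
  have hψmeas : ∀ j, Measurable (ψ j) := fun j => (hψ j).continuous.measurable
  have hθm : Measurable θ := Measurable.tsum hψmeas
  set φ := signedCoord θ with hφ
  have hφm : Measurable φ := measurable_signedCoord hθm
  -- Borel–Cantelli: along almost every orbit the series for `θ` is a finite sum at each point, so
  -- the default value of `tsum` plays no role there.
  have hfin : ∀ᵐ x ∂μ, ∀ t : ℕ, ∀ᶠ j in atTop, ψ j (twoShiftMap^[t] x) = 0 := by
    rw [ae_all_iff]
    intro t
    refine (hmp.iterate t).quasiMeasurePreserving.ae
      (p := fun x => ∀ᶠ j in atTop, ψ j x = 0) ?_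
    have h := ae_eventually_notMem (μ := μ) (s := fun j => {x | ψ j x ≠ 0})
      (ne_top_of_le_ne_top ENNReal.ofReal_ne_top
        (tsum_measure_le_of_halving hδhalf hδpos hψm 0))
    filter_upwards [h] with x hx
    filter_upwards [hx] with j hj
    simpa using hj
  have hθeq : ∀ {x : TwoShift} {K : ℕ}, (∀ j ≥ K, ψ j x = 0) →
      θ x = ∑ j ∈ Finset.range K, ψ j x := by
    intro x K hK
    exact tsum_eq_sum fun j hj => hK j (by simpa using hj)
  have hconj : ∀ x : TwoShift, (∀ᶠ j in atTop, ψ j x = 0) →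
      (∀ᶠ j in atTop, ψ j (twoShiftMap x) = 0) →
      M x = slRot (θ (twoShiftMap x)) * slDiag (φ x) * slRot (-θ x) := by
    intro x h1 h2
    obtain ⟨K, hK⟩ := eventually_atTop.1 (h1.and h2)
    have e1 := hθeq fun j hj => (hK j hj).1
    have e2 := hθeq fun j hj => (hK j hj).2
    have e3 : θ (twoShiftMap x) = ω x + θ x := by
      have : ω x = ∑ j ∈ Finset.range K, (ψ j (twoShiftMap x) - ψ j x) := by
        refine tsum_eq_sum fun j hj => ?_
        have := hK j (by simpa using hj)
        rw [this.1, this.2, sub_zero]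
      rw [this, e1, e2, Finset.sum_sub_distrib, sub_add_cancel]
    by_cases hx : x 0 = 1
    · have e4 : ∃ k : ℤ, θ x = k * (Real.pi / 2) := by
        rw [e1]
        exact (IsPhase.sum hψ K).exists_eq x hx
      have e5 : θ (twoShiftMap x) = θ x := by
        rw [e1, e2]
        exact (IsPhase.sum hψ K).map_eq x hx
      have e6 : ω x = 0 := by linarith
      have e7 : φ x = Real.cos (2 * θ x) := by simp [hφ, signedCoord, hx]
      rw [e5, e7, slRot_mul_slDiag_mul_slRot_neg e4]
      simp [hM, e6, hx, slRot_zero]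
    · have hx' : x 0 = 0 := by
        generalize x 0 = b at hx
        fin_cases b <;> simp_all
      rw [hφ, signedCoord_of_ne hx, slDiag_zero, mul_one, ← slRot_add, e3, add_neg_cancel_right]
      simp [hM, hx', slDiag_zero]
  have hlog : ∀ᵐ x ∂μ, ∀ k, logNormIter twoShiftMap M k x = |birkhoffSum twoShiftMap φ k x| := by
    filter_upwards [hfin] with x hx k
    refine logNormIter_eq_of_conj (θ := θ) (fun t => ?_) k
    have h := hconj _ (hx t) (by simpa only [Function.iterate_succ_apply'] using hx (t + 1))
    rw [Function.iterate_succ_apply']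
    exact h
  set lam := ∫ x, φ x ∂μ with hlam
  have hlamα : α / 2 ≤ lam := by
    set B : Set TwoShift := ⋃ j, {x | ψ (j + 0) x ≠ 0} with hB
    have hBm : MeasurableSet B := MeasurableSet.iUnion fun j =>
      measurableSet_eq_fun (hψmeas _) measurable_const |>.compl
    have hBμ : μ.real B ≤ 2 * δ 0 := measureReal_iUnion_le_of_halving hδhalf hδpos hψm 0
    have hA := (isClopen_coord_eq 0 1).2.measurableSet
    -- Off `B` the angle is `0` and the potential is the indicator of `x 0 = 1`; on `B` it drops by
    -- at most `2`. Integrating gives `α - 2 * (2 * δ 0) = α / 2`.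
    have hle : ∀ x, {x : TwoShift | x 0 = 1}.indicator (1 : TwoShift → ℝ) x -
        2 * B.indicator (1 : TwoShift → ℝ) x ≤ φ x := by
      intro x
      by_cases hxB : x ∈ B
      · have h1 := abs_le.1 (abs_signedCoord_le θ x)
        have h2 : {x : TwoShift | x 0 = 1}.indicator (1 : TwoShift → ℝ) x ≤ 1 :=
          Set.indicator_le_self' (by simp) x
        rw [Set.indicator_of_mem hxB, Pi.one_apply]
        linarith [h1.1]
      · have h1 : θ x = 0 := by
          have : ∀ j, ψ j x = 0 := by simpa [hB] using hxB
          simp [hθ, this]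
        rw [Set.indicator_of_notMem hxB, hφ, signedCoord, h1, fin_two_val_eq]
        by_cases hx : x 0 = 1 <;> simp [hx]
    have hi1 : Integrable ({x : TwoShift | x 0 = 1}.indicator (1 : TwoShift → ℝ)) μ :=
      (integrable_const (1 : ℝ)).indicator hA
    have hi2 : Integrable (B.indicator (1 : TwoShift → ℝ)) μ :=
      (integrable_const (1 : ℝ)).indicator hBm
    have h := integral_mono (hi1.sub (hi2.const_mul 2))
      (integrable_of_abs_le hφm (abs_signedCoord_le θ)) hle
    simp only [Pi.sub_apply] at h
    rw [integral_sub hi1 (hi2.const_mul 2), integral_const_mul, integral_indicator_one hA,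
      integral_indicator_one hBm] at h
    rw [hδ0] at hBμ
    linarith
  have hlampos : 0 < lam := by linarith
  have hfreq : ∃ᶠ k : ℕ in atTop,
      ENNReal.ofReal (u k) ≤ μ {x | logNormIter twoShiftMap M k x ≤ k * lam / 2} := by
    rw [frequently_atTop]
    intro i
    refine ⟨n i, hn i, ?_⟩
    set A := {x | |birkhoffSum twoShiftMap
      (signedCoord fun y => ∑ j ∈ Finset.range (i + 1), ψ j y) (n i) x| ≤ n i * (α / 4)} with hA
    set B : Set TwoShift := ⋃ j, {x | ψ (j + (i + 1)) x ≠ 0} with hB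
    have hBm : MeasurableSet B := MeasurableSet.iUnion fun j =>
      measurableSet_eq_fun (hψmeas _) measurable_const |>.compl
    have hBμ : μ.real B ≤ 2 * δ (i + 1) :=
      measureReal_iUnion_le_of_halving hδhalf hδpos hψm (i + 1)
    set D := ⋃ t ∈ Finset.range (n i), twoShiftMap^[t] ⁻¹' B with hD
    have hDμ : μ.real D ≤ u (n i) := by
      refine (measureReal_biUnion_finset_le _ _).trans ?_
      simp only [hmp.measureReal_iterate_preimage hBm, Finset.sum_const, Finset.card_range,
        nsmul_eq_mul]
      exact (mul_le_mul_of_nonneg_left hBμ (Nat.cast_nonneg _)).trans (hnδ i)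
    -- Outside `D` the later phases vanish during the first `n i` steps, so the Birkhoff sum is that
    -- of stage `i`. Removing `D` costs at most `u (n i)` of the available `2 * u (n i)`.
    have hsub : A ≤ᵐ[μ] ({x | logNormIter twoShiftMap M (n i) x ≤ n i * lam / 2} ∪ D :
        Set TwoShift) := by
      filter_upwards [hlog] with x hx hxA
      by_cases hxD : x ∈ D
      · exact Or.inr hxD
      left
      change logNormIter twoShiftMap M (n i) x ≤ n i * lam / 2
      have hxA' : |birkhoffSum twoShiftMap
        (signedCoord fun y => ∑ j ∈ Finset.range (i + 1), ψ j y) (n i) x| ≤ n i * (α / 4) := hxA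
      have heq : birkhoffSum twoShiftMap φ (n i) x = birkhoffSum twoShiftMap
          (signedCoord fun y => ∑ j ∈ Finset.range (i + 1), ψ j y) (n i) x := by
        refine Finset.sum_congr rfl fun t ht => ?_
        have hxt : twoShiftMap^[t] x ∉ B := fun h => hxD (Set.mem_biUnion ht h)
        have h0 : ∀ j ≥ i + 1, ψ j (twoShiftMap^[t] x) = 0 := by
          intro j hj
          obtain ⟨d, rfl⟩ := Nat.exists_eq_add_of_le' hj
          by_contra h
          exact hxt (Set.mem_iUnion.2 ⟨d, h⟩)
        rw [hφ, signedCoord, signedCoord, hθeq h0]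
      rw [hx, heq]
      refine hxA'.trans ?_
      have : (n i : ℝ) * (α / 2) ≤ n i * lam := by gcongr
      linarith
    have h1 := ENNReal.toReal_mono (measure_ne_top _ _) (measure_mono_ae hsub)
    have h2 := (hdev i).trans (h1.trans (measureReal_union_le _ _))
    rw [ENNReal.ofReal_le_iff_le_toReal (measure_ne_top _ _)]
    change u (n i) ≤ μ.real _
    linarith
  refine ⟨M, lam, hMc, ?_, hlampos, hfreq,
    fun hu => not_hasExpLargeDeviations_of_frequently hlampos hfreq hu⟩
  filter_upwards [hlog, hμ.ae_tendsto_birkhoffSum_div hφm (abs_signedCoord_le θ)] with x hx1 hx2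
  have h := hx2.abs
  rw [abs_of_pos hlampos] at h
  refine h.congr fun k => ?_
  rw [hx1, abs_div, Nat.abs_cast]
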